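/- For integers $q\ge 2$ and $j\ge 0$ let $r\in\{0,\dots,q-1\}$ be the residue of $j$ modulo $q$, and put $$\nu'_q(j+1)=\begin{cases}0 & \text{if } j<q-1,\\[2pt] \dfrac{2^{j}-2^{r}}{2^{q}-1} & \text{if } j\ge q-1 \text{ and } r<q-1,\\[8pt] 1+\dfrac{2^{j}-2^{q-1}}{2^{q}-1} & \text{if } j\ge q-1 \text{ and } r=q-1.\end{cases}$$ Let $\phi$ denote the Euler totient function. Then, for every integer $j\ge 1$, $$\sum_{3\le q\le j}\phi(q)\,\nu'_q(j)=\frac{2^{j}-(-1)^{j}}{3}-1 .$$ -/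

import Mathlib

/-- The numbers `ν'_q(n)`, for `q ≥ 2` and `n ≥ 1`. Writing `n = j + 1` and `r = j mod q`, one has
`ν'_q(j + 1) = 0` if `j < q - 1`; for `j ≥ q - 1` the value is `(2 ^ j - 2 ^ r) / (2 ^ q - 1)` if
`r < q - 1`, and `1 + (2 ^ j - 2 ^ (q - 1)) / (2 ^ q - 1)` if `r = q - 1`.
The index `n = 0` is not used; the value there is set to `0`. -/
def nuPrime (q : ℕ) : ℕ → ℚ
  | 0 => 0
  | j + 1 =>
    if j + 1 < q then 0
    else if j % q + 1 < q then ((2 : ℚ) ^ j - 2 ^ (j % q)) / (2 ^ q - 1)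
    else 1 + ((2 : ℚ) ^ j - 2 ^ (q - 1)) / (2 ^ q - 1)

theorem Nat.succ_mod_of_not_dvd {q j : ℕ} (h : ¬ q ∣ j + 1) : (j + 1) % q = j % q + 1 := by
  rcases Nat.eq_zero_or_pos q with rfl | hq
  · simp
  have h1 := Nat.mod_lt j hq
  have h2 : (j + 1) % q = (j % q + 1) % q := by simp
  rcases Nat.lt_or_ge (j % q + 1) q with h3 | h3
  · rw [h2, Nat.mod_eq_of_lt h3]
  · have h4 : j % q + 1 = q := by omega
    rw [h4, Nat.mod_self] at h2
    exact absurd (Nat.dvd_of_mod_eq_zero h2) h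

theorem Nat.mod_succ_eq_of_dvd {q j : ℕ} (hq : 0 < q) (h : q ∣ j + 1) : j % q + 1 = q := by
  have h1 := Nat.mod_lt j hq
  rcases Nat.lt_or_ge (j % q + 1) q with h3 | h3
  · have h2 : (j + 1) % q = (j % q + 1) % q := by simp
    rw [Nat.mod_eq_of_lt h3, Nat.mod_eq_zero_of_dvd h] at h2
    omega
  · omega

/-- The quotient `(2 ^ j - 2 ^ (j mod q)) / (2 ^ q - 1)`. -/
def twoPowQuot (q j : ℕ) : ℚ := ((2 : ℚ) ^ j - 2 ^ (j % q)) / (2 ^ q - 1)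

theorem two_pow_sub_one_ne_zero {q : ℕ} (hq : 0 < q) : (2 : ℚ) ^ q - 1 ≠ 0 :=
  (sub_pos.2 (one_lt_pow₀ one_lt_two hq.ne')).ne'

theorem twoPowQuot_zero (q : ℕ) : twoPowQuot q 0 = 0 := by simp [twoPowQuot]

theorem twoPowQuot_succ {q : ℕ} (hq : 0 < q) (j : ℕ) :
    twoPowQuot q (j + 1) = 2 * twoPowQuot q j + if q ∣ j + 1 then 1 else 0 := by
  have h0 := two_pow_sub_one_ne_zero hq
  unfold twoPowQuot
  split_ifs with h
  · have h1 : (2 : ℚ) ^ q = 2 ^ (j % q) * 2 := by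
      rw [← pow_succ, Nat.mod_succ_eq_of_dvd hq h]
    rw [Nat.mod_eq_zero_of_dvd h]
    field_simp
    rw [h1]
    ring
  · rw [Nat.succ_mod_of_not_dvd h]
    ring

theorem nuPrime_succ {q : ℕ} (hq : 0 < q) (j : ℕ) :
    nuPrime q (j + 1) = twoPowQuot q j + if q ∣ j + 1 then 1 else 0 := by
  rw [nuPrime, twoPowQuot]
  by_cases h : q ∣ j + 1
  · have h1 := Nat.mod_succ_eq_of_dvd hq h
    have h2 : ¬ j + 1 < q := (Nat.le_of_dvd j.succ_pos h).not_gt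
    have h3 : q - 1 = j % q := by omega
    rw [if_neg h2, if_neg (by omega), if_pos h, h3, add_comm]
  · rw [if_neg h, add_zero]
    split_ifs with h1 h2
    · simp [Nat.mod_eq_of_lt (Nat.lt_of_succ_lt h1)]
    · rfl
    · have h3 := Nat.succ_mod_of_not_dvd h
      have h4 := Nat.mod_lt (j + 1) hq
      omega

theorem ite_two_dvd_eq (n : ℕ) : (if 2 ∣ n then (1 : ℚ) else 0) = (1 + (-1) ^ n) / 2 := by
  split_ifs with h <;> rw [← even_iff_two_dvd] at h
  · norm_num [h.neg_one_pow]
  · norm_num [(Nat.not_even_iff_odd.1 h).neg_one_pow]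

theorem sum_totient_dvd_Icc_three {n N : ℕ} (hn : 0 < n) (hN : n ≤ N) :
    ∑ q ∈ Finset.Icc 3 N, (Nat.totient q : ℚ) * (if q ∣ n then 1 else 0)
      = n - 1 - (1 + (-1) ^ n) / 2 := by
  have h1 : ∑ q ∈ Finset.Icc 1 (N + 2), (Nat.totient q : ℚ) * (if q ∣ n then 1 else 0) = n := by
    simp only [mul_ite, mul_one, mul_zero]
    rw [← Finset.sum_filter]
    have : (Finset.Icc 1 (N + 2)).filter (· ∣ n) = n.divisors := by
      ext q
      simp only [Finset.mem_filter, Finset.mem_Icc, Nat.mem_divisors]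
      constructor
      · exact fun h => ⟨h.2, hn.ne'⟩
      · intro h
        have := Nat.le_of_dvd hn h.1
        have := Nat.pos_of_dvd_of_pos h.1 hn
        exact ⟨⟨by omega, by omega⟩, h.1⟩
    rw [this]
    exact_mod_cast Nat.sum_totient n
  have h2 : ∑ q ∈ Finset.Icc 3 (N + 2), (Nat.totient q : ℚ) * (if q ∣ n then 1 else 0)
      = ∑ q ∈ Finset.Icc 3 N, (Nat.totient q : ℚ) * (if q ∣ n then 1 else 0) := by
    symm
    apply Finset.sum_subset (Finset.Icc_subset_Icc_right (by omega))
    intro q hq hq'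
    rw [Finset.mem_Icc] at hq hq'
    rw [if_neg, mul_zero]
    intro h
    have := Nat.le_of_dvd hn h
    omega
  have h3 : Finset.Icc 1 (N + 2) = insert 1 (insert 2 (Finset.Icc 3 (N + 2))) := by
    ext q
    simp only [Finset.mem_insert, Finset.mem_Icc]
    omega
  rw [h3, Finset.sum_insert (by simp), Finset.sum_insert (by simp), h2, ite_two_dvd_eq] at h1
  simp only [Nat.totient_one, Nat.totient_two, one_dvd, if_true] at h1
  push_cast at h1
  linarith

theorem sum_totient_mul_twoPowQuot {j N : ℕ} (hj : j ≤ N) :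
    ∑ q ∈ Finset.Icc 3 N, (Nat.totient q : ℚ) * twoPowQuot q j
      = ((2 : ℚ) ^ (j + 1) + (-1) ^ j) / 3 - 1 - j + (1 - (-1) ^ j) / 2 := by
  induction j with
  | zero => norm_num [twoPowQuot_zero]
  | succ j ih =>
    have h : ∀ q ∈ Finset.Icc 3 N, (Nat.totient q : ℚ) * twoPowQuot q (j + 1)
        = 2 * (Nat.totient q * twoPowQuot q j)
          + Nat.totient q * (if q ∣ j + 1 then 1 else 0) := by
      intro q hq
      rw [twoPowQuot_succ (by rw [Finset.mem_Icc] at hq; omega)]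
      ring
    rw [Finset.sum_congr rfl h, Finset.sum_add_distrib, ← Finset.mul_sum, ih (by omega),
      sum_totient_dvd_Icc_three (Nat.add_one_pos j) hj]
    push_cast
    ring

theorem mainTheorem7 (j : ℕ) (hj : 1 ≤ j) :
    ∑ q ∈ Finset.Icc 3 j, (Nat.totient q : ℚ) * nuPrime q j
      = ((2 : ℚ) ^ j - (-1) ^ j) / 3 - 1 := by
  obtain ⟨j, rfl⟩ := Nat.exists_eq_add_of_le' hj
  have h : ∀ q ∈ Finset.Icc 3 (j + 1), (Nat.totient q : ℚ) * nuPrime q (j + 1)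
      = Nat.totient q * twoPowQuot q j + Nat.totient q * (if q ∣ j + 1 then 1 else 0) := by
    intro q hq
    rw [nuPrime_succ (by rw [Finset.mem_Icc] at hq; omega), mul_add]
  rw [Finset.sum_congr rfl h, Finset.sum_add_distrib, sum_totient_mul_twoPowQuot j.le_succ,
    sum_totient_dvd_Icc_three (Nat.add_one_pos j) le_rfl]
  push_cast
  ring
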